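/- Let $G$ be a connected simple graph (finite or infinite, not necessarily locally finite) with shortest-path distance $d$. For integers $k\ge 0$, $s_c,s_r,R\ge 1$, $\rho\ge 0$ and a vertex $v$, consider the following perfect-information game. The $k$ cops choose initial vertices $c_0^1,\dots,c_0^k$; then, knowing these, the robber chooses an initial vertex $r_0$. In stage $i\ge 1$, each cop first moves from $c_{i-1}^j$ to a vertex $c_i^j$ with $d(c_{i-1}^j,c_i^j)\le s_c$; the robber is captured if $d(r_{i-1},c_i^j)\le\rho$ for some $j$; otherwise he moves to a vertex $r_i$ along a path of length at most $s_r$ all of whose vertices are at distance greater than $\rho$ from every $c_i^j$. The cops win if the robber is captured or there is $N>0$ with $d(v,r_i)>R$ for all $i\ge N$. Call $G$ $\mathsf{CopWin}(k,s_c,\rho,s_r,R)$ if for every vertex $v$ the cops have a winning strategy in this game, and call $G$ $k$-strong cop win if $$\exists s_c\ge 1\ \ \forall s_r\ge 1\ \ \exists \rho\ge 0\ \ \forall R\ge 1:\quad G \text{ is } \mathsf{CopWin}(k,s_c,\rho,s_r,R).$$ The strong cop number $\mathrm{sco}(G)\in\mathbb N\cup\{\infty\}$ is the infimum of the integers $k$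 such that $G$ is $k$-strong cop win ($\infty$ if there is none). The graph $G$ is hyperbolic if there is a real $\delta\ge 0$ such that for all vertices $x,y,z$ and all geodesics $P_1,P_2,P_3$ from $x$ to $y$, from $y$ to $z$ and from $x$ to $z$, every vertex of each $P_i$ is at distance at most $\delta$ from a vertex of $\bigcup_{j\neq i}P_j$. A finitely generated group is hyperbolic if its Cayley graph with respect to some finite generating set is hyperbolic. **Theorem.** (1) For every connected graph $G$, $\mathrm{sco}(G)=1$ if and only if $G$ is hyperbolic. (2) For every finitely generated group $\Gamma$ and every finite generating set $S$ of $\Gamma$, the Cayley graph $\mathrm{Cay}(\Gamma,S)$ satisfies $\mathrm{sco}(\mathrm{Cay}(\Gamma,S))=1$ if and only if $\Gamma$ is hyperbolic. -/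

import Mathlib

namespace CoarseCops

/-! Throughout, `G.dist` is the shortest path distance `d_G`.  It is only used on connected graphs,
where it has its usual meaning. -/

section Game

variable {V : Type*}

/-- A strategy for `k` cops of speed `sc` in the perfect information game.
`init` gives the initial positions. After `n` completed stages, `move n c r` gives the next
positions of the cops as a function of the whole history of the game, that is, of the positions
`c 0, …, c n` of the cops and `r 0, …, r n` of the robber. Each cop moves by at most `sc`. -/
structure CopStrategy (G : SimpleGraph V) (k sc : ℕ) where
  init : Fin k → V
  move : (n : ℕ) → (Fin (n + 1) → Fin k → V) → (Fin (n + 1) → V) → Fin k → V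
  speed : ∀ (n : ℕ) (c : Fin (n + 1) → Fin k → V) (r : Fin (n + 1) → V) (j : Fin k),
    G.dist (c (Fin.last n) j) (move n c r j) ≤ sc

/-- The cops follow the strategy `σ` in the play in which `c i` and `r i` are the positions at the
end of stage `i` (the initial positions for `i = 0`). -/
def CopStrategy.Follows {G : SimpleGraph V} {k sc : ℕ} (σ : CopStrategy G k sc)
    (c : ℕ → Fin k → V) (r : ℕ → V) : Prop :=
  c 0 = σ.init ∧
    ∀ n : ℕ, c (n + 1) = σ.move n (fun i : Fin (n + 1) => c i) (fun i : Fin (n + 1) => r i)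

/-- The robber is captured during stage `i + 1`: after the move of the cops in that stage, some cop
is at distance at most `ρ` from the robber. -/
def CapturedAt (G : SimpleGraph V) {k : ℕ} (ρ : ℕ) (c : ℕ → Fin k → V) (r : ℕ → V) (i : ℕ) : Prop :=
  ∃ j : Fin k, G.dist (r i) (c (i + 1) j) ≤ ρ

/-- A legal move of a robber of speed `sr` from `x` to `y` while the cops are at `c`: there is a path
of length at most `sr` all of whose vertices are at distance larger than `ρ` from all the cops. -/
def RobberMove (G : SimpleGraph V) {k : ℕ} (ρ sr : ℕ) (c : Fin k → V) (x y : V) : Prop :=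
  ∃ p : G.Walk x y, p.IsPath ∧ p.length ≤ sr ∧ ∀ w ∈ p.support, ∀ j : Fin k, ρ < G.dist w (c j)

/-- As long as he has not been captured, the robber makes legal moves. (Positions after a capture
are irrelevant.) -/
def RobberLegal (G : SimpleGraph V) {k : ℕ} (ρ sr : ℕ) (c : ℕ → Fin k → V) (r : ℕ → V) : Prop :=
  ∀ n : ℕ, (∀ i ≤ n, ¬ CapturedAt G ρ c r i) → RobberMove G ρ sr (c (n + 1)) (r n) (r (n + 1))

/-- `CopWin G k sc ρ sr R`: for any vertex `v`, the `k` cops with speed `sc` and reach `ρ` can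
eventually protect the `R`-ball centered at `v` against a robber of speed `sr`, i.e. they have a
strategy such that in every play the robber is captured, or from some stage on he stays at
distance larger than `R` from `v`. -/
def CopWin (G : SimpleGraph V) (k sc ρ sr R : ℕ) : Prop :=
  ∀ v : V, ∃ σ : CopStrategy G k sc, ∀ (c : ℕ → Fin k → V) (r : ℕ → V),
    σ.Follows c r → RobberLegal G ρ sr c r →
      (∃ i : ℕ, CapturedAt G ρ c r i) ∨ ∃ N : ℕ, 0 < N ∧ ∀ i ≥ N, R < G.dist v (r i)

/-- `G` is `k`-strong cop win. -/
def StrongCopWin (G : SimpleGraph V) (k : ℕ) : Prop :=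
  ∃ sc : ℕ, 0 < sc ∧ ∀ sr : ℕ, 0 < sr → ∃ ρ : ℕ, ∀ R : ℕ, 0 < R → CopWin G k sc ρ sr R

/-- The strong cop number: the infimum of the `k` such that `G` is `k`-strong cop win, which is `⊤`
if there is no such `k`. -/
noncomputable def strongCopNumber (G : SimpleGraph V) : ℕ∞ :=
  ⨅ (k : ℕ) (_ : StrongCopWin G k), (k : ℕ∞)

end Game

section Hyperbolic

variable {V : Type*}

/-- A geodesic is a shortest walk (necessarily a path) between its endpoints. -/
def IsGeodesic {G : SimpleGraph V} {x y : V} (p : G.Walk x y) : Prop :=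
  p.length = G.dist x y

/-- Every vertex of `P` is at distance at most `δ` from a vertex of `Q`. -/
def InNeighborhood (G : SimpleGraph V) (δ : ℝ) (P Q : Set V) : Prop :=
  ∀ u ∈ P, ∃ w ∈ Q, (G.dist u w : ℝ) ≤ δ

/-- The geodesic triangle with sides `p₁, p₂, p₃` is `δ`-slim: each side lies in the
`δ`-neighborhood of the union of the two others. -/
def IsSlimTriangle (G : SimpleGraph V) (δ : ℝ) {x y z : V}
    (p₁ : G.Walk x y) (p₂ : G.Walk y z) (p₃ : G.Walk x z) : Prop :=
  InNeighborhood G δ {u | u ∈ p₁.support} ({u | u ∈ p₂.support} ∪ {u | u ∈ p₃.support}) ∧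
  InNeighborhood G δ {u | u ∈ p₂.support} ({u | u ∈ p₁.support} ∪ {u | u ∈ p₃.support}) ∧
  InNeighborhood G δ {u | u ∈ p₃.support} ({u | u ∈ p₁.support} ∪ {u | u ∈ p₂.support})

/-- `G` is `δ`-hyperbolic: all its geodesic triangles are `δ`-slim. -/
def IsDeltaHyperbolic (G : SimpleGraph V) (δ : ℝ) : Prop :=
  ∀ (x y z : V) (p₁ : G.Walk x y) (p₂ : G.Walk y z) (p₃ : G.Walk x z),
    IsGeodesic p₁ → IsGeodesic p₂ → IsGeodesic p₃ → IsSlimTriangle G δ p₁ p₂ p₃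

/-- `G` is (Gromov-)hyperbolic. -/
def IsHyperbolic (G : SimpleGraph V) : Prop :=
  ∃ δ : ℝ, 0 ≤ δ ∧ IsDeltaHyperbolic G δ

/-- A group is hyperbolic if its Cayley graph with respect to some finite generating set is
hyperbolic. -/
def IsHyperbolicGroup (Γ : Type*) [Group Γ] : Prop :=
  ∃ S : Set Γ, S.Finite ∧ Subgroup.closure S = ⊤ ∧ IsHyperbolic (SimpleGraph.mulCayley S)

end Hyperbolic

end CoarseCops

/-! Both directions pass through fat squares: closed four-sided circuits with sides of length at
most `L` and opposite sides more than `D` apart. If large fat squares with `L = K * D` exist, one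
cop loses. His speed is fixed before the robber's, so a robber who is faster by a factor of order
`K` can keep running around a large square to a corner whose two sides are far from the cop, and
never leaves a ball (`FatSquare.not_copWin`). Hence a strong cop win excludes large fat squares for
every `K` (`StrongCopWin.not_fatSquare`). If there are no large fat squares for `K = 500`, geodesic
triangles are slim: where a side strays far from the other two, a piece of it, two connections and a
detour along the other sides bound a fat square (`isHyperbolic_of_not_fatSquare`). In a hyperbolic
graph the cop wins by advancing one step per stage along a geodesic from `v` to the current robber
position; slimness bounds his speed by `2 * d + 1`, independently of the robber's speed
(`IsHyperbolic.strongCopWin`). For groups, fat squares survive a bi-Lipschitz change of metric with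
a different `K`. Since hyperbolicity excludes them for all `K`, it does not depend on the finite
generating set. -/

namespace CoarseCops

/-! ### Graphs without large fat squares are hyperbolic. -/

section FatSquares

variable {V : Type*} {G : SimpleGraph V}

/-- `x` and `y` are joined by a walk of length at most `n` inside `S`. -/
def JoinedIn (G : SimpleGraph V) (S : Set V) (n : ℕ) (x y : V) : Prop :=
  ∃ w : G.Walk x y, w.length ≤ n ∧ ∀ z ∈ w.support, z ∈ S

lemma JoinedIn.refl {S : Set V} {x : V} (hx : x ∈ S) : JoinedIn G S 0 x x :=
  ⟨.nil, by simp, by simpa using hx⟩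

lemma JoinedIn.symm {S : Set V} {n : ℕ} {x y : V} (h : JoinedIn G S n x y) :
    JoinedIn G S n y x := by
  obtain ⟨w, hw, hS⟩ := h
  exact ⟨w.reverse, by simpa using hw, by simpa using hS⟩

lemma JoinedIn.trans {S : Set V} {m n : ℕ} {x y z : V} (h : JoinedIn G S m x y)
    (h' : JoinedIn G S n y z) : JoinedIn G S (m + n) x z := by
  obtain ⟨w, hw, hS⟩ := h
  obtain ⟨w', hw', hS'⟩ := h'
  refine ⟨w.append w', by rw [SimpleGraph.Walk.length_append]; omega, fun u hu => ?_⟩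
  rcases (SimpleGraph.Walk.mem_support_append_iff _ _).1 hu with h | h
  exacts [hS _ h, hS' _ h]

lemma JoinedIn.mono {S S' : Set V} {m n : ℕ} {x y : V} (h : JoinedIn G S m x y)
    (hS : S ⊆ S') (hmn : m ≤ n) : JoinedIn G S' n x y := by
  obtain ⟨w, hw, hw'⟩ := h
  exact ⟨w, hw.trans hmn, fun z hz => hS (hw' z hz)⟩

lemma JoinedIn.left_mem {S : Set V} {n : ℕ} {x y : V} (h : JoinedIn G S n x y) : x ∈ S := by
  obtain ⟨w, -, hw⟩ := h
  exact hw _ w.start_mem_support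

lemma JoinedIn.right_mem {S : Set V} {n : ℕ} {x y : V} (h : JoinedIn G S n x y) : y ∈ S :=
  h.symm.left_mem

lemma dist_le_of_mem_support {x y z : V} (w : G.Walk x y) (hz : z ∈ w.support) :
    G.dist x z ≤ w.length := by
  classical
  exact (SimpleGraph.dist_le (w.takeUntil z hz)).trans (w.length_takeUntil_le_length hz)

lemma joinedIn_ball (hG : G.Connected) (x y : V) :
    JoinedIn G {z | G.dist x z ≤ G.dist x y} (G.dist x y) x y := by
  obtain ⟨w, hw⟩ := hG.exists_walk_length_eq_dist x y
  exact ⟨w, hw.le, fun z hz => hw ▸ dist_le_of_mem_support w hz⟩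

/-- A square whose four sides have length at most `L`, opposite sides being at distance more than
`D`. -/
def FatSquare (G : SimpleGraph V) (D L : ℕ) : Prop :=
  ∃ (q : Fin 4 → V) (A : Fin 4 → Set V), (∀ i, JoinedIn G (A i) L (q i) (q (i + 1))) ∧
    ∀ i, ∀ x ∈ A i, ∀ y ∈ A (i + 2), D < G.dist x y

lemma FatSquare.of_sides {A B C E : Set V} {a b c e : V} {D L : ℕ} (hA : JoinedIn G A L a b)
    (hB : JoinedIn G B L b c) (hC : JoinedIn G C L c e) (hE : JoinedIn G E L e a)
    (hAC : ∀ x ∈ A, ∀ y ∈ C, D < G.dist x y) (hBE : ∀ x ∈ B, ∀ y ∈ E, D < G.dist x y) :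
    FatSquare G D L := by
  refine ⟨![a, b, c, e], ![A, B, C, E], fun i => ?_, fun i x hx y hy => ?_⟩
  · fin_cases i
    exacts [hA, hB, hC, hE]
  · fin_cases i
    · exact hAC x hx y hy
    · exact hBE x hx y hy
    · exact SimpleGraph.dist_comm (G := G) ▸ hAC y hy x hx
    · exact SimpleGraph.dist_comm (G := G) ▸ hBE y hy x hx

lemma FatSquare.mono {D L L' : ℕ} (h : FatSquare G D L) (hL : L ≤ L') : FatSquare G D L' := by
  obtain ⟨q, A, h₁, h₂⟩ := h
  exact ⟨q, A, fun i => (h₁ i).mono subset_rfl hL, h₂⟩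

/-- The vertices `f 0, …, f n` are those of a geodesic of length `n`, in order. -/
def IsGeodesicSeq (G : SimpleGraph V) (f : ℕ → V) (n : ℕ) : Prop :=
  ∀ i j, i ≤ j → j ≤ n → i + G.dist (f i) (f j) = j

lemma IsGeodesic.isGeodesicSeq (hG : G.Connected) {x y : V} {p : G.Walk x y}
    (hp : IsGeodesic p) : IsGeodesicSeq G p.getVert p.length := by
  have key : ∀ j k, G.dist (p.getVert j) (p.getVert (j + k)) ≤ k := fun j k => by
    have h := SimpleGraph.dist_le ((p.drop j).take k)
    rw [SimpleGraph.Walk.take_length] at h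
    exact SimpleGraph.Walk.drop_getVert p j k ▸ h.trans (min_le_left _ _)
  intro i j hij hj
  have h₁ := key 0 i
  have h₂ := key i (j - i)
  have h₃ := key j (p.length - j)
  rw [zero_add, p.getVert_zero] at h₁
  rw [Nat.add_sub_cancel' hij] at h₂
  rw [Nat.add_sub_cancel' hj, p.getVert_length] at h₃
  have h₄ := hG.dist_triangle (u := x) (v := p.getVert i) (w := y)
  have h₅ := hG.dist_triangle (u := p.getVert i) (v := p.getVert j) (w := y)
  have h₆ : p.length = G.dist x y := hp
  omega

lemma IsGeodesicSeq.shift {f : ℕ → V} {m n : ℕ} (h : IsGeodesicSeq G f n) (hm : m ≤ n) :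
    IsGeodesicSeq G (fun i => f (m + i)) (n - m) := fun i j hij hj => by
  have := h (m + i) (m + j) (by omega) (by omega)
  dsimp only
  omega

lemma IsGeodesicSeq.joinedIn {f : ℕ → V} {n i j : ℕ} (h : IsGeodesicSeq G f n) (hij : i ≤ j)
    (hj : j ≤ n) : JoinedIn G {z | ∃ k, i ≤ k ∧ k ≤ j ∧ f k = z} (j - i) (f i) (f j) := by
  induction j, hij using Nat.le_induction with
  | base =>
    have hi : f i ∈ {z | ∃ k, i ≤ k ∧ k ≤ i ∧ f k = z} := ⟨i, le_rfl, le_rfl, rfl⟩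
    exact (JoinedIn.refl hi).mono subset_rfl (by omega)
  | succ j hij ih =>
    have hadj : G.Adj (f j) (f (j + 1)) := by
      have := h j (j + 1) (by omega) hj
      rw [← SimpleGraph.dist_eq_one_iff_adj]
      omega
    have hlast : JoinedIn G {z | ∃ k, i ≤ k ∧ k ≤ j + 1 ∧ f k = z} 1 (f j) (f (j + 1)) := by
      refine ⟨hadj.toWalk, by simp, fun z hz => ?_⟩
      simp only [SimpleGraph.Walk.support_cons, SimpleGraph.Walk.support_nil, List.mem_cons,
        List.not_mem_nil, or_false] at hz
      rcases hz with rfl | rfl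
      exacts [⟨j, hij, by omega, rfl⟩, ⟨j + 1, by omega, le_rfl, rfl⟩]
    refine (((ih (by omega)).mono ?_ le_rfl).trans hlast).mono subset_rfl (by omega)
    rintro z ⟨k, hk, hk', rfl⟩
    exact ⟨k, hk, by omega, rfl⟩

/-- The maximum is the absolute value of `i - j`, in a form that `omega` handles without knowing the
order of the indices. -/
lemma IsGeodesicSeq.dist_eq {f : ℕ → V} {n i j : ℕ} (h : IsGeodesicSeq G f n) (hi : i ≤ n)
    (hj : j ≤ n) : (G.dist (f i) (f j) : ℤ) = max ((i : ℤ) - j) (j - i) := by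
  rcases le_total i j with hij | hij
  · have := h i j hij hj
    omega
  · have := h j i hij hi
    rw [SimpleGraph.dist_comm] at this
    omega

lemma IsGeodesicSeq.joinedIn_range {f : ℕ → V} {n i j : ℕ} (h : IsGeodesicSeq G f n)
    (hi : i ≤ n) (hj : j ≤ n) :
    JoinedIn G {z | ∃ k ≤ n, f k = z} (G.dist (f i) (f j)) (f i) (f j) := by
  have h' := h.dist_eq hi hj
  have hsub : ∀ i j, j ≤ n → {z | ∃ k, i ≤ k ∧ k ≤ j ∧ f k = z} ⊆ {z | ∃ k ≤ n, f k = z} := by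
    rintro i j hj z ⟨k, -, hk, rfl⟩
    exact ⟨k, hk.trans hj, rfl⟩
  rcases le_total i j with hij | hij
  · exact (h.joinedIn hij hj).mono (hsub _ _ hj) (by omega)
  · exact (h.joinedIn hij hi).symm.mono (hsub _ _ hi) (by omega)

/-- The segment of a geodesic around `f u`, the rest of it together with connections from `f s` to
`a` and from `f t` to `b`, and a path from `b` to `a` far from `f u`, form a fat square. -/
lemma fatSquare_of_detour (hG : G.Connected) {f : ℕ → V} {n N L s u t : ℕ} {a b : V} {S : Set V}
    (hf : IsGeodesicSeq G f n) (hN : 0 < N) (hs : s + 2 * N + G.dist (f s) a ≤ u)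
    (ht : u + 2 * N + G.dist (f t) b ≤ t) (htn : t ≤ n) (hsL : 2 * (u - s) ≤ L)
    (htL : 2 * (t - u) ≤ L) (hS : JoinedIn G S L b a) (hfar : ∀ z ∈ S, 3 * N ≤ G.dist (f u) z) :
    FatSquare G N L := by
  have tri : ∀ x y z, G.dist x z ≤ G.dist x y + G.dist y z := fun x y z => hG.dist_triangle
  have comm : ∀ x y, G.dist x y = G.dist y x := fun x y => SimpleGraph.dist_comm
  refine FatSquare.of_sides (A := {z | ∃ k, u - N ≤ k ∧ k ≤ u + N ∧ f k = z})
    (B := {z | ∃ k, u + N ≤ k ∧ k ≤ t ∧ f k = z} ∪ {z | G.dist (f t) z ≤ G.dist (f t) b})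
    (C := S)
    (E := {z | ∃ k, s ≤ k ∧ k ≤ u - N ∧ f k = z} ∪ {z | G.dist (f s) z ≤ G.dist (f s) a})
    (a := f (u - N)) (b := f (u + N)) (c := b) (e := a) ?_ ?_ hS ?_ ?_ ?_
  · exact (hf.joinedIn (by omega) (by omega)).mono subset_rfl (by omega)
  · exact (((hf.joinedIn (by omega) htn).mono Set.subset_union_left le_rfl).trans
      ((joinedIn_ball hG _ _).mono Set.subset_union_right le_rfl)).mono subset_rfl (by omega)
  · exact (((hf.joinedIn (i := s) (j := u - N) (by omega)
      (by omega)).symm.mono Set.subset_union_left le_rfl).trans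
      ((joinedIn_ball hG _ _).mono Set.subset_union_right le_rfl)).symm.mono subset_rfl (by omega)
  -- The middle segment has radius `N` about `f u`, so it is at least `2 * N` away from `S`.
  · rintro x ⟨k, hk, hk', rfl⟩ y hy
    have h₁ := hf.dist_eq (i := u) (j := k) (by omega) (by omega)
    have h₂ := hfar y hy
    have h₃ := tri (f u) (f k) y
    omega
  · rintro x (⟨k, hk, hk', rfl⟩ | hx) y (⟨l, hl, hl', rfl⟩ | hy)
    · have h₁ := hf.dist_eq (i := k) (j := l) (by omega) (by omega)
      omega
    · have h₁ := hf.dist_eq (i := s) (j := k) (by omega) (by omega)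
      have h₂ := tri (f s) y (f k)
      have h₃ := comm (f k) y
      simp only [Set.mem_ofPred_eq] at hy
      omega
    · have h₁ := hf.dist_eq (i := l) (j := t) (by omega) (by omega)
      have h₂ := tri (f l) x (f t)
      have h₃ := comm (f l) x
      have h₄ := comm (f t) x
      simp only [Set.mem_ofPred_eq] at hx
      omega
    · have h₁ := hf.dist_eq (i := s) (j := t) (by omega) (by omega)
      have h₂ := tri (f s) y (f t)
      have h₃ := tri y x (f t)
      have h₄ := comm (f t) x
      have h₅ := comm x y
      simp only [Set.mem_ofPred_eq] at hx hy
      omega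

/-- Take `f u` as far from `Q` as possible, at distance about `4 * N`. By maximality, points of the
geodesic a few `N` before and after `u` are still joined to `Q` by short paths, which end at `a` and
`b`. It then remains only to join `b` to `a` away from `f u`; any path inside `Q` is far enough. -/
lemma exists_detour (hG : G.Connected) {f : ℕ → V} {n B m : ℕ} {Q : Set V}
    (hf : IsGeodesicSeq G f n) (h₀ : ∃ q ∈ Q, G.dist (f 0) q ≤ m)
    (hn : ∃ q ∈ Q, G.dist (f n) q ≤ m) (hm : 4 * m ≤ B) (hB : 12 ≤ B)
    (hfar : ¬ ∀ t ≤ n, ∃ q ∈ Q, G.dist (f t) q ≤ B) :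
    ∃ N u a b, B ≤ 4 * N + 2 ∧ a ∈ Q ∧ b ∈ Q ∧ (∀ q ∈ Q, 4 * N ≤ G.dist (f u) q) ∧
      G.dist (f u) a ≤ 12 * N ∧ G.dist (f u) b ≤ 12 * N ∧
      ∀ S L, JoinedIn G S L b a → (∀ z ∈ S, 3 * N ≤ G.dist (f u) z) → 14 * N ≤ L →
        FatSquare G N L := by
  classical
  have tri : ∀ x y z, G.dist x z ≤ G.dist x y + G.dist y z := fun x y z => hG.dist_triangle
  obtain ⟨q₀, hq₀, hd₀⟩ := h₀
  obtain ⟨q₁, hq₁, hd₁⟩ := hn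
  have hex : ∃ M, ∀ t ≤ n, ∃ q ∈ Q, G.dist (f t) q ≤ M := by
    refine ⟨n + m, fun t ht => ⟨q₀, hq₀, ?_⟩⟩
    have h₁ := tri (f t) (f 0) q₀
    have h₂ := hf.dist_eq ht (Nat.zero_le n)
    omega
  obtain ⟨M, hM, hmin⟩ : ∃ M, (∀ t ≤ n, ∃ q ∈ Q, G.dist (f t) q ≤ M) ∧
      ∀ M' < M, ¬ ∀ t ≤ n, ∃ q ∈ Q, G.dist (f t) q ≤ M' :=
    ⟨Nat.find hex, Nat.find_spec hex, fun M' h => Nat.find_min hex h⟩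
  have hBM : B < M := by
    by_contra h
    refine hfar fun t ht => ?_
    obtain ⟨q, hq, hd⟩ := hM t ht
    exact ⟨q, hq, by omega⟩
  have h := hmin (M - 1) (by omega)
  push Not at h
  obtain ⟨u, hu, hfu⟩ := h
  have hfu₀ := hfu q₀ hq₀
  have hfu₁ := hfu q₁ hq₁
  have htri₀ := tri (f u) (f 0) q₀
  have htri₁ := tri (f u) (f n) q₁
  have hu₀ := hf.dist_eq hu (Nat.zero_le n)
  have hu₁ := hf.dist_eq hu le_rfl
  -- Since `M ≥ 13`, this gives `4 * N ≤ M ≤ 5 * N`, so moving `7 * N` away from `u` leaves room for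
  -- `2 * N` plus a connection of length at most `M`. If the geodesic ends sooner, its endpoint
  -- serves, being within `m ≤ N` of `Q`.
  obtain ⟨N, hN⟩ : ∃ N, N = M / 4 := ⟨_, rfl⟩
  obtain ⟨s, a, ha, hs, hsu⟩ : ∃ s, ∃ a ∈ Q, s + 2 * N + G.dist (f s) a ≤ u ∧ u ≤ s + 7 * N ∧
      G.dist (f s) a ≤ 5 * N := by
    rcases le_or_gt (7 * N) u with h7 | h7
    · obtain ⟨a, ha, hd⟩ := hM (u - 7 * N) (by omega)
      exact ⟨u - 7 * N, a, ha, by omega, by omega, by omega⟩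
    · exact ⟨0, q₀, hq₀, by omega, by omega, by omega⟩
  obtain ⟨t, b, hb, ht, htn, htu⟩ : ∃ t, ∃ b ∈ Q, u + 2 * N + G.dist (f t) b ≤ t ∧ t ≤ n ∧
      t ≤ u + 7 * N ∧ G.dist (f t) b ≤ 5 * N := by
    rcases le_or_gt (u + 7 * N) n with h7 | h7
    · obtain ⟨b, hb, hd⟩ := hM (u + 7 * N) h7
      exact ⟨u + 7 * N, b, hb, by omega, by omega, by omega, by omega⟩
    · exact ⟨n, q₁, hq₁, by omega, le_rfl, by omega, by omega⟩
  have hsd := hf.dist_eq hu (show s ≤ n by omega)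
  have htd := hf.dist_eq hu htn
  refine ⟨N, u, a, b, by omega, ha, hb, fun q hq => ?_, ?_, ?_, fun S L hS hSfar hL => ?_⟩
  · have := hfu q hq
    omega
  · have := tri (f u) (f s) a
    omega
  · have := tri (f u) (f t) b
    omega
  · exact fatSquare_of_detour hG hf (by omega) hs ht htn (by omega) (by omega) hS hSfar

/-- Geodesics with a common end fellow travel in the absence of large fat squares. -/
lemma near_of_common_end (hG : G.Connected) {D₀ : ℕ}
    (hfat : ∀ D ≥ D₀, ¬ FatSquare G D (500 * D)) {f g : ℕ → V} {n n' m B : ℕ}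
    (hf : IsGeodesicSeq G f n) (hg : IsGeodesicSeq G g n') (hend : f n = g n')
    (hm : G.dist (f 0) (g 0) ≤ m) (hmB : 4 * m ≤ B) (hB : 4 * D₀ + 12 ≤ B) :
    ∀ t ≤ n, ∃ q ∈ {z | ∃ k ≤ n', g k = z}, G.dist (f t) q ≤ B := by
  by_contra hfar
  obtain ⟨N, u, a, b, hN, ⟨i, hi, rfl⟩, ⟨j, hj, rfl⟩, hQ, ha, hb, hsq⟩ :=
    exists_detour hG hf (m := m) (Q := {z | ∃ k ≤ n', g k = z}) ⟨g 0, ⟨0, by omega, rfl⟩, hm⟩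
      ⟨g n', ⟨n', le_rfl, rfl⟩, by simp [hend]⟩ hmB
      (by omega) hfar
  have hab : G.dist (g j) (g i) ≤ G.dist (g j) (f u) + G.dist (f u) (g i) := hG.dist_triangle
  rw [SimpleGraph.dist_comm (u := g j) (v := f u)] at hab
  refine hfat N (by omega) (hsq _ _ ((hg.joinedIn_range hj hi).mono subset_rfl (by omega))
    (fun z hz => ?_) (by omega))
  have := hQ z hz
  omega

/-- From any vertex on one of two geodesics ending at `z` there is a geodesic to `z` inside their
union. -/
lemma IsGeodesicSeq.exists_tail {g g' : ℕ → V} {n n' : ℕ} (hg : IsGeodesicSeq G g n)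
    (hg' : IsGeodesicSeq G g' n') (hend : g n = g' n') {a : V}
    (ha : a ∈ {v | ∃ k ≤ n, g k = v} ∪ {v | ∃ k ≤ n', g' k = v}) :
    ∃ (h : ℕ → V) (l : ℕ), IsGeodesicSeq G h l ∧ h 0 = a ∧ h l = g n ∧
      {v | ∃ k ≤ l, h k = v} ⊆ {v | ∃ k ≤ n, g k = v} ∪ {v | ∃ k ≤ n', g' k = v} := by
  rcases ha with ⟨k, hk, rfl⟩ | ⟨k, hk, rfl⟩
  · refine ⟨_, _, hg.shift hk, rfl, by simp [Nat.add_sub_cancel' hk], ?_⟩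
    rintro v ⟨l, hl, rfl⟩
    exact Or.inl ⟨k + l, by omega, rfl⟩
  · refine ⟨_, _, hg'.shift hk, rfl, by simp [Nat.add_sub_cancel' hk, hend], ?_⟩
    rintro v ⟨l, hl, rfl⟩
    exact Or.inr ⟨k + l, by omega, rfl⟩

/-- In the absence of large fat squares, a side of a geodesic triangle is near the two others. -/
lemma near_of_triangle (hG : G.Connected) {D₀ B : ℕ}
    (hfat : ∀ D ≥ D₀, ¬ FatSquare G D (500 * D)) {f g g' : ℕ → V} {n l l' : ℕ}
    (hf : IsGeodesicSeq G f n) (hg : IsGeodesicSeq G g l) (hg' : IsGeodesicSeq G g' l')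
    (h₀ : f 0 = g 0) (h₁ : f n = g' 0) (hend : g l = g' l') (hB : 4 * D₀ + 16 ≤ B) :
    ∀ t ≤ n, ∃ q ∈ {v | ∃ k ≤ l, g k = v} ∪ {v | ∃ k ≤ l', g' k = v}, G.dist (f t) q ≤ B := by
  have tri : ∀ x y z, G.dist x z ≤ G.dist x y + G.dist y z := fun x y z => hG.dist_triangle
  have comm : ∀ x y, G.dist x y = G.dist y x := fun x y => SimpleGraph.dist_comm
  by_contra hfar
  obtain ⟨N, u, a, b, hN, ha, hb, hQ, hua, hub, hsq⟩ :=
    exists_detour hG hf (m := 0) ⟨g 0, Or.inl ⟨0, by omega, rfl⟩, by simp [h₀]⟩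
      ⟨g' 0, Or.inr ⟨0, by omega, rfl⟩, by simp [h₁]⟩ (by omega) (by omega) hfar
  obtain ⟨α, nα, hα, hα₀, hα₁, hαQ⟩ := hg.exists_tail hg' hend ha
  obtain ⟨β, nβ, hβ, hβ₀, hβ₁, hβQ⟩ := hg.exists_tail hg' hend hb
  have hab := tri a (f u) b
  have hcua := comm a (f u)
  -- The detour follows `α` for `115 * N`, crosses to `β`, and returns to `b`. The starting points
  -- are within `24 * N`, so the crossing costs at most `100 * N ≥ 4 * (24 * N)`; it stays `115 - 12
  -- - 100 = 3` times `N` away from `f u`. The return is at most `(24 + 115 + 100) * N`, for a total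
  -- of `454 * N`, below `500 * N`. If `α` is shorter than `115 * N`, the crossing is the common
  -- endpoint.
  obtain ⟨t, s, ht, hs, ht', hts, hclose⟩ : ∃ t s, t ≤ nα ∧ s ≤ nβ ∧ t ≤ 115 * N ∧
      G.dist (α t) (β s) ≤ 100 * N ∧
      ∀ z, G.dist (α t) z ≤ G.dist (α t) (β s) → 3 * N ≤ G.dist (f u) z := by
    rcases le_or_gt (115 * N) nα with h | h
    · obtain ⟨_, ⟨s, hs, rfl⟩, hd⟩ := near_of_common_end hG hfat hα hβ (by rw [hα₁, hβ₁])
        (m := 24 * N) (B := 100 * N) (by rw [hα₀, hβ₀]; omega) (by omega) (by omega) _ h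
      refine ⟨115 * N, s, h, hs, le_rfl, hd, fun z hz => ?_⟩
      have e₁ := hα.dist_eq (Nat.zero_le _) h
      have e₂ := tri (α 0) (f u) (α (115 * N))
      have e₃ := tri (f u) z (α (115 * N))
      have e₄ := comm z (α (115 * N))
      rw [hα₀] at e₁ e₂
      omega
    · refine ⟨nα, nβ, le_rfl, le_rfl, h.le, by simp [hα₁, hβ₁], fun z hz => ?_⟩
      rw [hα₁, hβ₁, SimpleGraph.dist_self, Nat.le_zero, hG.dist_eq_zero_iff] at hz
      have := hQ z (hz ▸ Or.inl ⟨l, le_rfl, rfl⟩)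
      omega
  have e₁ := hα.dist_eq (Nat.zero_le _) ht
  have e₂ := hβ.dist_eq (Nat.zero_le _) hs
  have e₃ := tri b a (β s)
  have e₄ := tri a (α t) (β s)
  have e₅ := comm b a
  have j₁ := hα.joinedIn_range (Nat.zero_le _) ht
  have j₂ := joinedIn_ball hG (α t) (β s)
  have j₃ := hβ.joinedIn_range hs (Nat.zero_le _)
  rw [hα₀] at e₁ j₁
  rw [hβ₀] at e₂ j₃
  have e₆ := comm b (β s)
  refine hfat N (by omega) (hsq ({z | ∃ k ≤ nα, α k = z} ∪
    {z | G.dist (α t) z ≤ G.dist (α t) (β s)} ∪ {z | ∃ k ≤ nβ, β k = z}) (500 * N) ?_ ?_ (by omega))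
  · refine (((j₁.mono ?_ le_rfl).trans (j₂.mono ?_ le_rfl)).trans
      (j₃.mono ?_ le_rfl)).symm.mono subset_rfl (by omega)
    · exact fun z hz => Or.inl (Or.inl hz)
    · exact fun z hz => Or.inl (Or.inr hz)
    · exact fun z hz => Or.inr hz
  · rintro z ((hz | hz) | hz)
    · have := hQ z (hαQ hz)
      omega
    · exact hclose z hz
    · have := hQ z (hβQ hz)
      omega

lemma setOf_getVert_eq {x y : V} (p : G.Walk x y) :
    {v | ∃ k ≤ p.length, p.getVert k = v} = {v | v ∈ p.support} := by
  ext v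
  simp only [Set.mem_ofPred_eq, SimpleGraph.Walk.mem_support_iff_exists_getVert]
  exact exists_congr fun k => and_comm

lemma IsGeodesic.reverse {x y : V} {p : G.Walk x y} (hp : IsGeodesic p) :
    IsGeodesic p.reverse := by
  have : p.length = G.dist x y := hp
  rw [IsGeodesic, SimpleGraph.Walk.length_reverse, this, SimpleGraph.dist_comm]

theorem isHyperbolic_of_not_fatSquare (hG : G.Connected) {D₀ : ℕ}
    (hfat : ∀ D ≥ D₀, ¬ FatSquare G D (500 * D)) : IsHyperbolic G := by
  have key : ∀ {x y z : V} (p : G.Walk x y) (q : G.Walk x z) (r : G.Walk y z), IsGeodesic p →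
      IsGeodesic q → IsGeodesic r → InNeighborhood G ((4 * D₀ + 16 : ℕ) : ℝ)
        {v | v ∈ p.support} ({v | v ∈ q.support} ∪ {v | v ∈ r.support}) := by
    intro x y z p q r hp hq hr v hv
    rw [← setOf_getVert_eq] at hv
    obtain ⟨k, hk, rfl⟩ := hv
    obtain ⟨w, hw, hd⟩ := near_of_triangle hG hfat (hp.isGeodesicSeq hG) (hq.isGeodesicSeq hG)
      (hr.isGeodesicSeq hG) (by simp) (by simp) (by simp) le_rfl k hk
    rw [setOf_getVert_eq, setOf_getVert_eq] at hw
    exact ⟨w, hw, by exact_mod_cast hd⟩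
  refine ⟨_, Nat.cast_nonneg (4 * D₀ + 16), fun x y z p q r hp hq hr => ⟨?_, ?_, ?_⟩⟩
  · rw [Set.union_comm]
    exact key p r q hp hr hq
  · simpa using key q p.reverse r.reverse hq hp.reverse hr.reverse
  · simpa using key r p q.reverse hr hp hq.reverse

end FatSquares

/-! ### A robber on a fat square evades one cop. -/

section Robber

variable {V : Type*} {G : SimpleGraph V}

/-- Since `σ` sees the whole history, the recursion carries entire sequences; after `n` stages only
their entries up to `n` are meaningful, and these never change again. -/
lemma exists_play {k sc : ℕ} (σ : CopStrategy G k sc) (start : (Fin k → V) → V)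
    (step : V → (Fin k → V) → V) :
    ∃ (c : ℕ → Fin k → V) (r : ℕ → V), σ.Follows c r ∧ r 0 = start (c 0) ∧
      ∀ n, r (n + 1) = step (r n) (c (n + 1)) := by
  let next : ℕ → (ℕ → Fin k → V) × (ℕ → V) → Fin k → V :=
    fun n h => σ.move n (fun i => h.1 i) (fun i => h.2 i)
  let H : ℕ → (ℕ → Fin k → V) × (ℕ → V) := fun n =>
    Nat.rec (fun _ => σ.init, fun _ => start σ.init)
      (fun n h => (Function.update h.1 (n + 1) (next n h),
        Function.update h.2 (n + 1) (step (h.2 n) (next n h)))) n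
  have hsucc : ∀ n, H (n + 1) = (Function.update (H n).1 (n + 1) (next n (H n)),
      Function.update (H n).2 (n + 1) (step ((H n).2 n) (next n (H n)))) := fun n => rfl
  have hstable : ∀ n, ∀ i ≤ n, (H n).1 i = (H i).1 i ∧ (H n).2 i = (H i).2 i := by
    intro n i hi
    induction n, hi using Nat.le_induction with
    | base => exact ⟨rfl, rfl⟩
    | succ n hi ih =>
      have hne : i ≠ n + 1 := by omega
      rw [← ih.1, ← ih.2, hsucc]
      exact ⟨Function.update_of_ne hne _ _, Function.update_of_ne hne _ _⟩
  have hnext : ∀ n, (H (n + 1)).1 (n + 1) = next n (H n) := fun n => by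
    rw [hsucc]
    exact Function.update_self _ _ _
  refine ⟨fun n => (H n).1 n, fun n => (H n).2 n, ⟨rfl, fun n => ?_⟩, rfl, fun n => ?_⟩
  · have h₁ : (fun i : Fin (n + 1) => (H i).1 i) = fun i : Fin (n + 1) => (H n).1 i :=
      funext fun i => (hstable n i (by omega)).1.symm
    have h₂ : (fun i : Fin (n + 1) => (H i).2 i) = fun i : Fin (n + 1) => (H n).2 i :=
      funext fun i => (hstable n i (by omega)).2.symm
    dsimp only
    rw [hnext, h₁, h₂]
  · dsimp only
    rw [hnext, hsucc]
    exact Function.update_self _ _ _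

/-- A positional invariant that the robber can maintain against one cop without leaving a ball. -/
lemma not_copWin_of_invariant {sc ρ sr R : ℕ} {v : V} (Inv : V → V → Prop)
    (hstart : ∀ c, ∃ r, Inv r c)
    (hstep : ∀ r c c', Inv r c → G.dist c c' ≤ sc → ρ < G.dist r c' ∧
      ∃ r', Inv r' c' ∧ RobberMove G ρ sr (fun _ : Fin 1 => c') r r')
    (hR : ∀ r c, Inv r c → G.dist v r ≤ R) : ¬ CopWin G 1 sc ρ sr R := by
  classical
  intro hwin
  obtain ⟨σ, hσ⟩ := hwin v
  choose start hstart using hstart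
  obtain ⟨c, r, hfol, hr₀, hr⟩ := exists_play σ (fun c => start (c 0))
    (fun r c => if h : ∃ r', Inv r' (c 0) ∧ RobberMove G ρ sr c r r' then h.choose else r)
  have hspeed : ∀ n, G.dist (c n 0) (c (n + 1) 0) ≤ sc := fun n => by
    have := σ.speed n (fun i => c i) (fun i => r i) 0
    rwa [← hfol.2 n] at this
  have hconst : ∀ n, (fun _ : Fin 1 => c n 0) = c n := fun n =>
    funext fun j => by rw [Subsingleton.elim j 0]
  have hmove : ∀ n, Inv (r n) (c n 0) →
      Inv (r (n + 1)) (c (n + 1) 0) ∧ RobberMove G ρ sr (c (n + 1)) (r n) (r (n + 1)) := by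
    intro n hn
    have h := (hstep _ _ _ hn (hspeed n)).2
    rw [hconst] at h
    rw [hr, dif_pos h]
    exact h.choose_spec
  have hInv : ∀ n, Inv (r n) (c n 0) := fun n => by
    induction n with
    | zero => exact hr₀ ▸ hstart _
    | succ n ih => exact (hmove n ih).1
  rcases hσ c r hfol fun n _ => (hmove n (hInv n)).2 with ⟨i, j, hj⟩ | ⟨N, -, hN⟩
  · have := (hstep _ _ _ (hInv i) (hspeed i)).1
    rw [Subsingleton.elim j 0] at hj
    omega
  · exact (hN N le_rfl).not_ge (hR _ _ (hInv N))

lemma JoinedIn.split {S : Set V} {m n : ℕ} {x y : V} (h : JoinedIn G S (m + n) x y) :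
    ∃ z, JoinedIn G S m x z ∧ JoinedIn G S n z y := by
  obtain ⟨w, hw, hS⟩ := h
  refine ⟨w.getVert m, ⟨w.take m, by rw [SimpleGraph.Walk.take_length]; omega, fun z hz => ?_⟩,
    ⟨w.drop m, by rw [SimpleGraph.Walk.drop_length]; omega, fun z hz => ?_⟩⟩
  · exact hS _ ((w.isSubwalk_take m).support_subset hz)
  · exact hS _ ((w.isSubwalk_drop m).support_subset hz)

lemma JoinedIn.robberMove {S : Set V} {k ρ n : ℕ} {c : Fin k → V} {x y : V}
    (h : JoinedIn G S n x y) (hS : ∀ z ∈ S, ∀ j, ρ < G.dist z (c j)) :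
    RobberMove G ρ n c x y := by
  classical
  obtain ⟨w, hw, hw'⟩ := h
  exact ⟨w.bypass, w.bypass_isPath, w.length_bypass_le_length.trans hw,
    fun z hz j => hS z (hw' z (w.support_bypass_subset_support hz)) j⟩

/-- The sides `A i` and `A (i + 1)` of a square are at distance more than `E` from `c`. -/
def ClearCorner (G : SimpleGraph V) (A : Fin 4 → Set V) (E : ℕ) (i : Fin 4) (c : V) : Prop :=
  (∀ x ∈ A i, E < G.dist x c) ∧ ∀ x ∈ A (i + 1), E < G.dist x c

/-- The cop cannot be near both sides of an opposite pair. One far side from each pair gives two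
adjacent sides. -/
lemma exists_clearCorner (hG : G.Connected) {A : Fin 4 → Set V} {D E : ℕ}
    (hA : ∀ i, ∀ x ∈ A i, ∀ y ∈ A (i + 2), D < G.dist x y) (hE : 2 * E ≤ D) (c : V) :
    ∃ i, ClearCorner G A E i c := by
  have key : ∀ i, (∀ x ∈ A i, E < G.dist x c) ∨ ∀ x ∈ A (i + 2), E < G.dist x c := by
    intro i
    by_contra! h
    obtain ⟨⟨x, hx, hxc⟩, y, hy, hyc⟩ := h
    have h₁ := hA i x hx y hy
    have h₂ : G.dist x y ≤ G.dist x c + G.dist c y := hG.dist_triangle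
    rw [SimpleGraph.dist_comm (u := c)] at h₂
    omega
  rcases key 0 with h₀ | h₀ <;> rcases key 1 with h₁ | h₁
  exacts [⟨0, h₀, h₁⟩, ⟨3, h₁, h₀⟩, ⟨1, h₁, h₀⟩, ⟨2, h₀, h₁⟩]

/-- Two sides suffice to reach the new clear corner, each of them clear of the old or of the new cop
position. Sides clear of `c` by `2 * E` remain clear of `c'` by `E`. -/
lemma ClearCorner.joinedIn (hG : G.Connected) {q : Fin 4 → V} {A : Fin 4 → Set V} {E L : ℕ}
    (hq : ∀ i, JoinedIn G (A i) L (q i) (q (i + 1))) {i i' : Fin 4} {c c' : V}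
    (hi : ClearCorner G A (2 * E) i c) (hi' : ClearCorner G A (2 * E) i' c')
    (hc : G.dist c c' ≤ E) :
    JoinedIn G {z | E < G.dist z c'} (2 * L) (q (i + 1)) (q (i' + 1)) := by
  have hfar : ∀ x, 2 * E < G.dist x c → E < G.dist x c' := fun x hx => by
    have h : G.dist x c ≤ G.dist x c' + G.dist c' c := hG.dist_triangle
    rw [SimpleGraph.dist_comm (u := c')] at h
    omega
  have h₀ : A i ⊆ {z | E < G.dist z c'} := fun x hx => hfar x (hi.1 x hx)
  have h₁ : A (i + 1) ⊆ {z | E < G.dist z c'} := fun x hx => hfar x (hi.2 x hx)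
  have h₂ : A i' ⊆ {z | E < G.dist z c'} := fun x hx =>
    lt_of_le_of_lt (by omega) (hi'.1 x hx)
  have hcases : i' = i ∨ i' = i + 1 ∨ i' = i + 1 + 1 ∨ i = i' + 1 := by
    clear * -
    revert i i'
    decide
  rcases hcases with rfl | rfl | rfl | rfl
  · exact (JoinedIn.refl (h₀ (hq _).right_mem)).mono subset_rfl (Nat.zero_le _)
  · exact (hq _).mono h₁ (by omega)
  · exact (((hq _).mono h₁ le_rfl).trans ((hq _).mono h₂ le_rfl)).mono subset_rfl (by omega)
  · exact ((hq _).mono h₀ (by omega)).symm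

lemma FatSquare.not_copWin (hG : G.Connected) {D L sc sr ρ T : ℕ} (h : FatSquare G D L)
    (hD : 4 * (sc * T + sc + ρ) ≤ D) (hL : 2 * L ≤ sr * T) :
    ∃ R, 0 < R ∧ ¬ CopWin G 1 sc ρ sr R := by
  obtain ⟨q, A, hq, hA⟩ := h
  obtain ⟨E, hE⟩ : ∃ E, E = sc * T + sc + ρ := ⟨_, rfl⟩
  have hcorner : ∀ c, ∃ i, ClearCorner G A (2 * E) i c :=
    exists_clearCorner hG hA (by omega)
  -- The robber plays in rounds: `c₀` is the cop's position when the round was planned, `q (i + 1)`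
  -- the target corner, and `j` the number of running stages left. The cop has used at most `T - j`
  -- moves, and the remaining route avoids `c₀` by `E`, hence the cop himself by `ρ`, even after his
  -- next move.
  refine ⟨sr * T + ∑ i, G.dist (q 0) (q i) + 1, by omega, not_copWin_of_invariant (v := q 0)
    (fun r c => ∃ (c₀ : V) (i : Fin 4) (j : ℕ), j ≤ T ∧ G.dist c₀ c + sc * j ≤ sc * T ∧
      ClearCorner G A (2 * E) i c₀ ∧
      JoinedIn G {z | E < G.dist z c₀} (sr * j) r (q (i + 1))) ?_ ?_ ?_⟩
  · intro c
    obtain ⟨i, hi⟩ := hcorner c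
    have hmem : q (i + 1) ∈ {z | E < G.dist z c} :=
      lt_of_le_of_lt (by omega) (hi.1 _ (hq i).right_mem)
    exact ⟨q (i + 1), c, i, 0, by omega, by simp, hi,
      (JoinedIn.refl hmem).mono subset_rfl (by omega)⟩
  · rintro r c c' ⟨c₀, i, j, hj, hc, hi, hw⟩ hcc'
    have hc₀ : G.dist c₀ c' ≤ G.dist c₀ c + G.dist c c' := hG.dist_triangle
    have hfar : ∀ z, E < G.dist z c₀ → ρ < G.dist z c' := fun z hz => by
      have : G.dist z c₀ ≤ G.dist z c' + G.dist c' c₀ := hG.dist_triangle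
      rw [SimpleGraph.dist_comm (u := c')] at this
      omega
    refine ⟨hfar r hw.left_mem, ?_⟩
    cases j with
    | zero =>
      -- At the target corner, the robber spends one stage standing still and plans a new round from
      -- `c'`. The term `sc` in `E` accounts for this extra cop move.
      obtain ⟨i', hi'⟩ := hcorner c'
      obtain ⟨w, hw₀, hwS⟩ := hw
      obtain rfl := SimpleGraph.Walk.eq_of_length_eq_zero (Nat.le_zero.1 (by simpa using hw₀))
      refine ⟨q (i + 1), ⟨c', i', T, le_rfl, by simp, hi', ?_⟩,
        (JoinedIn.mono (JoinedIn.refl (hwS _ w.start_mem_support)) subset_rfl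
          (Nat.zero_le _)).robberMove fun z hz _ => hfar z hz⟩
      exact (hi.joinedIn hG hq hi' (by omega)).mono subset_rfl hL
    | succ j =>
      rw [Nat.mul_succ, Nat.add_comm] at hw
      obtain ⟨r', hr', hw'⟩ := hw.split
      refine ⟨r', ⟨c₀, i, j, by omega, ?_, hi, hw'⟩, hr'.robberMove fun z hz _ => hfar z hz⟩
      rw [Nat.mul_succ] at hc
      omega
  · rintro r c ⟨c₀, i, j, hj, -, -, w, hw, -⟩
    have h₁ : G.dist (q 0) r ≤ G.dist (q 0) (q (i + 1)) + G.dist (q (i + 1)) r :=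
      hG.dist_triangle
    have h₂ := SimpleGraph.dist_le w.reverse
    rw [SimpleGraph.Walk.length_reverse] at h₂
    have h₃ : sr * j ≤ sr * T := Nat.mul_le_mul_left _ hj
    have h₄ : G.dist (q 0) (q (i + 1)) ≤ ∑ i, G.dist (q 0) (q i) :=
      Finset.single_le_sum (f := fun i => G.dist (q 0) (q i)) (fun _ _ => Nat.zero_le _)
        (Finset.mem_univ _)
    omega

theorem StrongCopWin.not_fatSquare (hG : G.Connected) (h : StrongCopWin G 1) (K : ℕ) :
    ∃ D₀, ∀ D ≥ D₀, ¬ FatSquare G D (K * D) := by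
  obtain ⟨sc, hsc, h⟩ := h
  -- With `T = D / (8 * sc)`, the cop covers at most `D / 8` in a round, while `D ≤ 16 * sc * T`
  -- lets the robber run two sides, of length `2 * K * D ≤ 32 * K * sc * T`. The `+ 1` keeps his
  -- speed positive when `K = 0`.
  obtain ⟨ρ, h⟩ := h (32 * K * sc + 1) (by omega)
  refine ⟨16 * (sc + ρ), fun D hD hfat => ?_⟩
  have h₁ : 8 * sc * (D / (8 * sc)) ≤ D := Nat.mul_div_le _ _
  have h₂ : D < 8 * sc * (D / (8 * sc)) + 8 * sc := Nat.lt_mul_div_succ D (by omega)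
  obtain ⟨T, hT⟩ : ∃ T, T = D / (8 * sc) := ⟨_, rfl⟩
  rw [← hT, mul_assoc] at h₁ h₂
  obtain ⟨R, hR, hwin⟩ := hfat.not_copWin hG (sc := sc) (sr := 32 * K * sc + 1) (ρ := ρ) (T := T)
    (by omega) (by
      have : K * D ≤ K * (16 * (sc * T)) := Nat.mul_le_mul_left _ (by omega)
      nlinarith)
  exact hwin (h R hR)

lemma not_strongCopWin_zero [Nonempty V] : ¬ StrongCopWin G 0 := by
  rintro ⟨sc, -, h⟩
  obtain ⟨ρ, h⟩ := h 1 one_pos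
  obtain ⟨v⟩ := ‹Nonempty V›
  obtain ⟨σ, hσ⟩ := h 1 one_pos v
  rcases hσ (fun _ => σ.init) (fun _ => v) ⟨rfl, fun _ => Subsingleton.elim _ _⟩
    (fun _ _ => ⟨.nil, by simp, by simp, fun _ _ j => j.elim0⟩) with ⟨_, j, _⟩ | ⟨N, -, hN⟩
  · exact j.elim0
  · simpa using hN N le_rfl

lemma strongCopNumber_eq_one_iff [Nonempty V] : strongCopNumber G = 1 ↔ StrongCopWin G 1 := by
  have hle : ∀ k, StrongCopWin G k → (1 : ℕ∞) ≤ k := fun k hk => by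
    rcases Nat.eq_zero_or_pos k with rfl | hpos
    · exact absurd hk not_strongCopWin_zero
    · exact_mod_cast hpos
  constructor
  · intro h
    by_contra hnot
    have h₂ : (2 : ℕ∞) ≤ strongCopNumber G := le_iInf₂ fun k hk => by
      have h₁ := hle k hk
      have hne : k ≠ 1 := fun e => hnot (e ▸ hk)
      have h₁' : 1 ≤ k := by exact_mod_cast h₁
      exact_mod_cast (show 2 ≤ k by omega)
    rw [h] at h₂
    exact absurd h₂ (by decide)
  · intro h
    exact le_antisymm (iInf₂_le_of_le 1 h (by simp)) (le_iInf₂ hle)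

end Robber

/-! ### One cop wins on a hyperbolic graph. -/

section Cop

variable {V : Type*} {G : SimpleGraph V}

/-- The cop starts at `v` and, in stage `n + 1`, goes to the `n + 1`-st vertex of a geodesic from
`v` to the robber whenever his speed allows it. -/
theorem IsHyperbolic.strongCopWin (hG : G.Connected) (h : IsHyperbolic G) : StrongCopWin G 1 := by
  classical
  obtain ⟨δ, -, hδ⟩ := h
  obtain ⟨d, hd⟩ := exists_nat_ge δ
  have tri : ∀ x y z, G.dist x z ≤ G.dist x y + G.dist y z := fun x y z => hG.dist_triangle
  have comm : ∀ x y, G.dist x y = G.dist y x := fun x y => SimpleGraph.dist_comm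
  refine ⟨2 * d + 1, by omega, fun sr _ => ⟨sr + d, fun R _ v => ?_⟩⟩
  choose γ hγ using fun x => hG.exists_walk_length_eq_dist v x
  have hgeo : ∀ x, IsGeodesicSeq G (γ x).getVert (G.dist v x) := fun x =>
    hγ x ▸ IsGeodesic.isGeodesicSeq hG (hγ x)
  have hend : ∀ x n, G.dist v x ≤ n → (γ x).getVert n = x := fun x n hn =>
    (γ x).getVert_of_length_le (by rw [hγ]; exact hn)
  refine ⟨⟨fun _ => v, fun n c r j => if G.dist (c (Fin.last n) j)
    ((γ (r (Fin.last n))).getVert (n + 1)) ≤ 2 * d + 1 then (γ (r (Fin.last n))).getVert (n + 1)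
    else c (Fin.last n) j, fun n c r j => ?_⟩, fun c r hfol hlegal => ?_⟩
  · split_ifs with h
    exacts [h, by simp]
  by_contra! hno
  obtain ⟨hfree, hno⟩ := hno
  have hcop : ∀ n, G.dist (c n 0) ((γ (r n)).getVert (n + 1)) ≤ 2 * d + 1 →
      c (n + 1) 0 = (γ (r n)).getVert (n + 1) ∧ n + 1 < G.dist v (r n) := by
    intro n hn
    have hc : c (n + 1) 0 = (γ (r n)).getVert (n + 1) := by
      rw [hfol.2 n]
      exact if_pos hn
    refine ⟨hc, ?_⟩
    -- `getVert` past the end of a walk returns its endpoint, so the cop would stand on the robber.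
    by_contra! hle
    refine hfree n ⟨0, ?_⟩
    rw [hc, hend _ _ hle]
    simp
  have key : ∀ n, c (n + 1) 0 = (γ (r n)).getVert (n + 1) ∧ n + 1 < G.dist v (r n) := by
    intro n
    induction n with
    | zero =>
      refine hcop 0 ?_
      have hc₀ : c 0 0 = v := by rw [hfol.1]
      rw [hc₀]
      rcases Nat.eq_zero_or_pos (G.dist v (r 0)) with h | h
      · rw [hend _ _ (by omega), h]
        omega
      · have := (hgeo (r 0)).dist_eq (j := 1) (Nat.zero_le _) h
        rw [SimpleGraph.Walk.getVert_zero] at this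
        simp only [zero_add]
        omega
    | succ n ih =>
      obtain ⟨hc, hlt⟩ := ih
      refine hcop (n + 1) ?_
      obtain ⟨p, -, hp, -⟩ := hlegal n fun i _ => hfree i
      have hmove := (SimpleGraph.dist_le p).trans hp
      have hcap : sr + d < G.dist (r n) (c (n + 1) 0) := by
        by_contra! hle
        exact hfree n ⟨0, hle⟩
      obtain ⟨p₂, hp₂⟩ := hG.exists_walk_length_eq_dist (r n) (r (n + 1))
      obtain ⟨w, hw, hdw⟩ := (hδ v (r n) (r (n + 1)) (γ _) p₂ (γ _) (hγ _) hp₂ (hγ _)).1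
        (c (n + 1) 0) (hc ▸ SimpleGraph.Walk.getVert_mem_support _ _)
      have hdw' : G.dist (c (n + 1) 0) w ≤ d := by exact_mod_cast hdw.trans hd
      -- If the cop is within `d` of the short side joining the robber's positions, he is within `sr
      -- + d = ρ` of `r n`, a capture. Otherwise he is within `d` of the `k`-th vertex of the new
      -- geodesic; comparing distances to `v`, `k` differs from `n + 1` by at most `d`, so the next
      -- target is within `d + (d + 1)`.
      rcases hw with hw | hw
      · have h₁ := dist_le_of_mem_support p₂ hw
        have h₂ := tri (r n) w (c (n + 1) 0)
        have h₃ := comm w (c (n + 1) 0)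
        omega
      · obtain ⟨k, rfl, hk⟩ := SimpleGraph.Walk.mem_support_iff_exists_getVert.1 hw
        rw [hγ] at hk
        have e₁ := (hgeo (r n)).dist_eq (Nat.zero_le _) hlt.le
        have e₂ := (hgeo (r (n + 1))).dist_eq (Nat.zero_le _) hk
        rw [SimpleGraph.Walk.getVert_zero] at e₁ e₂
        rw [← hc] at e₁
        have t₁ := tri v (c (n + 1) 0) ((γ (r (n + 1))).getVert k)
        have t₂ := tri v ((γ (r (n + 1))).getVert k) (c (n + 1) 0)
        have t₃ := comm ((γ (r (n + 1))).getVert k) (c (n + 1) 0)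
        have t₄ := tri (c (n + 1) 0) ((γ (r (n + 1))).getVert k)
          ((γ (r (n + 1))).getVert (n + 1 + 1))
        rcases le_total (n + 1 + 1) (G.dist v (r (n + 1))) with hn | hn
        · have e₃ := (hgeo (r (n + 1))).dist_eq hk hn
          omega
        · have e₃ := (hgeo (r (n + 1))).dist_eq hk le_rfl
          rw [hend _ _ le_rfl] at e₃
          rw [hend _ _ hn] at t₄ ⊢
          omega
  obtain ⟨i, hi, hle⟩ := hno (R + 1) (by omega)
  have := (key i).2
  omega

theorem strongCopWin_iff_isHyperbolic (hG : G.Connected) : StrongCopWin G 1 ↔ IsHyperbolic G := by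
  refine ⟨fun h => ?_, fun h => h.strongCopWin hG⟩
  obtain ⟨D₀, hD₀⟩ := h.not_fatSquare hG 500
  exact isHyperbolic_of_not_fatSquare hG hD₀

end Cop

/-! ### Bi-Lipschitz invariance of hyperbolicity. -/

section BiLipschitz

variable {V : Type*} {G H : SimpleGraph V}

lemma dist_le_mul_dist (hG : G.Connected) (hH : H.Connected) {C : ℕ}
    (hC : ∀ x y, G.Adj x y → H.dist x y ≤ C) (x y : V) : H.dist x y ≤ C * G.dist x y := by
  have key : ∀ {x y : V} (w : G.Walk x y), H.dist x y ≤ C * w.length := by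
    intro x y w
    induction w with
    | nil => simp
    | @cons x u y hadj w ih =>
      have h₁ : H.dist x y ≤ H.dist x u + H.dist u y := hH.dist_triangle
      have h₂ := hC _ _ hadj
      rw [SimpleGraph.Walk.length_cons, Nat.mul_succ]
      omega
  obtain ⟨w, hw⟩ := hG.exists_walk_length_eq_dist x y
  exact hw ▸ key w

lemma JoinedIn.thicken (hH : H.Connected) {C : ℕ} (hC : ∀ x y, G.Adj x y → H.dist x y ≤ C)
    {S : Set V} {n : ℕ} {x y : V} (h : JoinedIn G S n x y) :
    JoinedIn H {z | ∃ s ∈ S, H.dist s z ≤ C} (C * n) x y := by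
  obtain ⟨w, hw, hS⟩ := h
  refine JoinedIn.mono (m := C * w.length) ?_ subset_rfl (Nat.mul_le_mul_left C hw)
  clear hw
  induction w with
  | @nil x =>
    refine (JoinedIn.refl ?_).mono subset_rfl (Nat.zero_le _)
    exact ⟨x, hS x (by simp), by simp⟩
  | @cons x u y hadj w ih =>
    have h₁ := hC _ _ hadj
    refine (((joinedIn_ball hH x u).mono ?_ h₁).trans
      (ih fun z hz => hS z (by simp [hz]))).mono subset_rfl ?_
    · exact fun z hz => ⟨x, hS x (by simp), le_trans hz h₁⟩
    · rw [SimpleGraph.Walk.length_cons, Nat.mul_succ, Nat.add_comm]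

/-- Each edge of a side is replaced by an `H`-geodesic of length at most `C`. The new sides lie
within `C` of the old ones, which costs `2 * C` in the separation. -/
lemma FatSquare.of_biLipschitz (hG : G.Connected) (hH : H.Connected) {C D D' L : ℕ}
    (hGH : ∀ x y, G.Adj x y → H.dist x y ≤ C) (hHG : ∀ x y, H.Adj x y → G.dist x y ≤ C)
    (hD : C * (D' + 2 * C) ≤ D) (h : FatSquare G D L) : FatSquare H D' (C * L) := by
  obtain ⟨q, A, hq, hA⟩ := h
  refine ⟨q, fun i => {z | ∃ s ∈ A i, H.dist s z ≤ C}, fun i => (hq i).thicken hH hGH, ?_⟩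
  rintro i x ⟨s, hs, hsx⟩ y ⟨t, ht, hty⟩
  by_contra! hxy
  have h₁ := hA i s hs t ht
  have h₂ := dist_le_mul_dist hH hG hHG s t
  have h₃ : H.dist s t ≤ H.dist s x + H.dist x t := hH.dist_triangle
  have h₄ : H.dist x t ≤ H.dist x y + H.dist y t := hH.dist_triangle
  rw [SimpleGraph.dist_comm (u := y)] at h₄
  have h₅ : C * H.dist s t ≤ C * (D' + 2 * C) := Nat.mul_le_mul_left C (by omega)
  omega

theorem IsHyperbolic.of_biLipschitz (hG : G.Connected) (hH : H.Connected) {C : ℕ}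
    (hGH : ∀ x y, G.Adj x y → H.dist x y ≤ C) (hHG : ∀ x y, H.Adj x y → G.dist x y ≤ C)
    (h : IsHyperbolic H) : IsHyperbolic G := by
  wlog hC : 0 < C generalizing C
  · exact this (C := C + 1) (fun x y hxy => (hGH x y hxy).trans (by omega))
      (fun x y hxy => (hHG x y hxy).trans (by omega)) (by omega)
  -- Transfer from `G` to `H` shrinks the width from `D` to `E = D / (2 * C)` and stretches sides to
  -- `C * (500 * D)`. As `D ≤ 4 * C * E`, the ratio becomes `2000 * C ^ 2`.
  obtain ⟨D₀, hD₀⟩ := (h.strongCopWin hH).not_fatSquare hH (2000 * C ^ 2)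
  refine isHyperbolic_of_not_fatSquare hG (D₀ := 4 * C ^ 2 + 2 * C * (D₀ + 1)) fun D hD hfat => ?_
  have h₁ : 2 * C * (D / (2 * C)) ≤ D := Nat.mul_div_le _ _
  have h₂ : D < 2 * C * (D / (2 * C)) + 2 * C := Nat.lt_mul_div_succ D (by omega)
  have h₃ : D₀ + 1 ≤ D / (2 * C) := (Nat.le_div_iff_mul_le (by omega)).2 (by
    rw [Nat.mul_comm]; omega)
  obtain ⟨E, hE⟩ : ∃ E, E = D / (2 * C) := ⟨_, rfl⟩
  rw [← hE] at h₁ h₂ h₃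
  refine hD₀ E (by omega) ((hfat.of_biLipschitz hG hH hGH hHG (D' := E) ?_).mono ?_)
  · nlinarith
  · have h₄ : D ≤ 4 * C * E := by nlinarith
    calc C * (500 * D) ≤ C * (500 * (4 * C * E)) := by gcongr
      _ = 2000 * C ^ 2 * E := by ring

end BiLipschitz

/-! ### Independence of the finite generating set. -/

section Cayley

variable {Γ : Type*} [Group Γ]

lemma mulCayley_connected {S : Set Γ} (hS : Subgroup.closure S = ⊤) :
    (SimpleGraph.mulCayley S).Connected := by
  have hadj : ∀ x, ∀ s ∈ S, (SimpleGraph.mulCayley S).Reachable x (x * s) := by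
    intro x s hs
    by_cases h : x = x * s
    · rw [← h]
    · exact SimpleGraph.Adj.reachable ((SimpleGraph.mulCayley_adj S _ _).2 ⟨h, by simp [hs]⟩)
  have key : ∀ x, (SimpleGraph.mulCayley S).Reachable 1 x := by
    intro x
    have hx : x ∈ Subgroup.closure S := hS ▸ Subgroup.mem_top x
    induction hx using Subgroup.closure_induction_right with
    | one => rfl
    | mul_right x _ s hs ih => exact ih.trans (hadj x s hs)
    | mul_inv_cancel x _ s hs ih =>
      refine ih.trans (SimpleGraph.Reachable.symm ?_)
      simpa using hadj (x * s⁻¹) s hs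
  exact ⟨fun x y => (key x).symm.trans (key y)⟩

lemma dist_mulCayley_mul_left {S : Set Γ} (hS : Subgroup.closure S = ⊤) (a x y : Γ) :
    (SimpleGraph.mulCayley S).dist (a * x) (a * y) ≤ (SimpleGraph.mulCayley S).dist x y := by
  obtain ⟨w, hw⟩ := (mulCayley_connected hS).exists_walk_length_eq_dist x y
  let φ : SimpleGraph.mulCayley S →g SimpleGraph.mulCayley S :=
    ⟨fun z => a * z, fun h => SimpleGraph.mulCayley_adj_mul_iff_right.2 h⟩
  rw [← hw, ← SimpleGraph.Walk.length_map φ w]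
  exact SimpleGraph.dist_le _

/-- Left translation does not increase distances, so it suffices to bound the `S`-lengths of the
finitely many elements of `T`. -/
lemma exists_dist_mulCayley_le {S T : Set Γ} (hS : Subgroup.closure S = ⊤) (hT : T.Finite) :
    ∃ C, ∀ x y, (SimpleGraph.mulCayley T).Adj x y → (SimpleGraph.mulCayley S).dist x y ≤ C := by
  obtain ⟨C, hC⟩ := (hT.image fun t => (SimpleGraph.mulCayley S).dist 1 t).bddAbove
  have key : ∀ x y, x⁻¹ * y ∈ T → (SimpleGraph.mulCayley S).dist x y ≤ C := fun x y h => by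
    have h₁ := dist_mulCayley_mul_left hS x 1 (x⁻¹ * y)
    rw [mul_one, mul_inv_cancel_left] at h₁
    exact h₁.trans (hC ⟨_, h, rfl⟩)
  refine ⟨C, fun x y hxy => ?_⟩
  rcases ((SimpleGraph.mulCayley_adj T _ _).1 hxy).2 with h | h
  · exact key x y h
  · rw [SimpleGraph.dist_comm]
    exact key y x h

theorem isHyperbolicGroup_iff {S : Set Γ} (hS : S.Finite) (hgen : Subgroup.closure S = ⊤) :
    IsHyperbolicGroup Γ ↔ IsHyperbolic (SimpleGraph.mulCayley S) := by
  refine ⟨fun ⟨T, hT, hgenT, h⟩ => ?_, fun h => ⟨S, hS, hgen, h⟩⟩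
  obtain ⟨C, hC⟩ := exists_dist_mulCayley_le hgenT hS
  obtain ⟨C', hC'⟩ := exists_dist_mulCayley_le hgen hT
  exact h.of_biLipschitz (mulCayley_connected hgen) (mulCayley_connected hgenT) (C := max C C')
    (fun x y hxy => (hC x y hxy).trans (le_max_left _ _))
    (fun x y hxy => (hC' x y hxy).trans (le_max_right _ _))

end Cayley

end CoarseCops

theorem theorem4p2 :
    (∀ (V : Type*) (G : SimpleGraph V), G.Connected →
      (CoarseCops.strongCopNumber G = 1 ↔ CoarseCops.IsHyperbolic G)) ∧
    (∀ (Γ : Type*) [Group Γ] (S : Set Γ), S.Finite → Subgroup.closure S = ⊤ →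
      (CoarseCops.strongCopNumber (SimpleGraph.mulCayley S) = 1 ↔
        CoarseCops.IsHyperbolicGroup Γ)) := by
  refine ⟨fun V G hG => ?_, fun Γ _ S hS hgen => ?_⟩
  · have := hG.nonempty
    rw [CoarseCops.strongCopNumber_eq_one_iff, CoarseCops.strongCopWin_iff_isHyperbolic hG]
  · rw [CoarseCops.strongCopNumber_eq_one_iff, CoarseCops.isHyperbolicGroup_iff hS hgen,
      CoarseCops.strongCopWin_iff_isHyperbolic (CoarseCops.mulCayley_connected hgen)]
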